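/- **Setting.** Let $(\mathbb X,\rho)$ be a quasi-metric space ($\rho\ge 0$, $\rho(x,y)=0$ iff $x=y$, $\rho$ symmetric, $\rho(x,z)\le\kappa(\rho(x,y)+\rho(y,z))$ for some constant $\kappa$) with the topology induced by $\rho$, and let $\mu$ be a Borel probability measure on $\mathbb X$. Let $\{\varphi_k\}_{k\ge 0}$ be an orthonormal basis of $L_2(\mathbb X,\mu)$ (real or complex) consisting of continuous functions with $\varphi_0\equiv 1$, and let $0=\lambda_0\le\lambda_1\le\dots$ be real numbers with $\lambda_k\to\infty$. Put $G_t(x,y)=\sum_{k\ge 0} e^{-\lambda_k^2 t}\varphi_k(x)\overline{\varphi_k(y)}$ for $t>0$. Assume that $\mathbb X$ is a *diffusion measure space* with exponent $\alpha>0$: there are constants $c_0,C_0>0$ such that 1. every closed ball $B_t(x)=\{y:\rho(x,y)\le t\}$ with $x\in\mathbb X$, $t>0$, is compact and $\mu(B_t(x))\le C_0t^\alpha$; 2. $|G_t(x,y)|\le C_0\,t^{-\alpha/2}\exp(-c_0\,\rho(x,y)^2/t)$ for all $x,y\in\mathbb X$ and $0<t\le 1$; 3. $G_t(x,x)\ge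 c_0\,t^{-\alpha/2}$ for all $x\in\mathbb X$ and $0<t<1$. For $N\ge 1$ let $\Pi_N=\operatorname{span}\{\varphi_k:\lambda_k\le N\}$. Let $B\subset\mathbb X$ be a nontrivial ball, i.e. a closed or open ball of positive radius, or $B=\mathbb X$. Let $L_p(B)$ be taken with respect to $\mu$ restricted to $B$. For $1\le p\le\infty$, $s>0$ and $f\in L_p(B)$ let $$\|f\|_{W^s(L_p(B))}=\|f\|_{L_p(B)}+\sup_{N=2^n,\ n=0,1,2,\dots}N^s\inf_{g\in\Pi_N}\|f-g\|_{L_p(B)},$$ and for $r>0$ let $$\overline{W^s_r}(L_p(B))=\{f\in L_p(B):\|f\|_{W^s(L_p(B))}\le r\}.$$ For a compact subset $Y$ of a metric space $E$ and $\varepsilon>0$, the metric entropy is $H_\varepsilon(Y,E)=\log_2 N_\varepsilon(Y)$, where $N_\varepsilon(Y)$ is the minimal number of open balls of radius $\varepsilon$ with centers in $E$ that cover $Y$. **Theorem 3.1.** Let $1\le p\le\infty$, let $s>0$ and let $B$ be a nontrivial ball in the diffusion measure space $\mathbb X$. Then $\overline{W^s_r}(L_p(B))$ is compact in $L_p(B)$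 for every $r>0$, and there are constants $c,C>0$, independent of $\varepsilon$ and $r$, such that $$c\,(r/\varepsilon)^{\alpha/s}\le H_\varepsilon\big(\overline{W^s_r}(L_p(B)),L_p(B)\big)\le C\,(r/\varepsilon)^{\alpha/s}\qquad\text{for all }0<\varepsilon\le r.$$ With the same constants, these inequalities also hold for all $0<\varepsilon<r$ when $N_\varepsilon$ counts closed balls instead of open ones. (For closed balls and $\varepsilon=r$ a single ball suffices, and the entropy is $0$.) -/

import Mathlib

open MeasureTheory Filter Topology Set
open scoped ENNReal NNReal

namespace DiffusionSpace

noncomputable section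

/-- `ρ` is a quasi-metric on `X` (a metric up to a constant `κ` in the triangle inequality), and the
topology of `X` is the one it induces: the balls around a point are a neighbourhood basis there. -/
structure IsQuasiMetric {X : Type*} [TopologicalSpace X] (ρ : X → X → ℝ) : Prop where
  nonneg : ∀ x y, 0 ≤ ρ x y
  eq_zero_iff : ∀ x y, ρ x y = 0 ↔ x = y
  symm : ∀ x y, ρ x y = ρ y x
  quasi_triangle : ∃ κ : ℝ, ∀ x y z, ρ x z ≤ κ * (ρ x y + ρ y z)
  nhds_basis : ∀ x, (𝓝 x).HasBasis (fun t : ℝ => 0 < t) (fun t => {y | ρ x y < t})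

/-- The closed ball `B_t(x)`. -/
def closedBall {X : Type*} (ρ : X → X → ℝ) (x : X) (t : ℝ) : Set X := {y | ρ x y ≤ t}

/-- The open ball. -/
def openBall {X : Type*} (ρ : X → X → ℝ) (x : X) (t : ℝ) : Set X := {y | ρ x y < t}

/-- A nontrivial ball: an open or closed ball of positive radius, or the whole space. -/
def IsNontrivialBall {X : Type*} (ρ : X → X → ℝ) (B : Set X) : Prop :=
  (∃ x t, 0 < t ∧ (B = closedBall ρ x t ∨ B = openBall ρ x t)) ∨ B = univ

/-- The generalized heat kernel `G_t(x,y) = ∑ₖ exp(-λₖ² t) φₖ(x) φₖ(y)*`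
(the conjugation does nothing over `ℝ`). -/
def heatKernel {X 𝕜 : Type*} [RCLike 𝕜] (φ : ℕ → X → 𝕜) (lam : ℕ → ℝ) (t : ℝ) (x y : X) : 𝕜 :=
  ∑' k, ((Real.exp (-(lam k) ^ 2 * t) : ℝ) : 𝕜) * φ k x * starRingEnd 𝕜 (φ k y)

/-- Diffusion measure spaces with volume-growth exponent `α`.
Convergence of the heat kernel is not listed since it follows from `heat_lower`: on the diagonal the
terms are nonnegative, and a divergent series would have the value `0` there; off the diagonal
the series then converges absolutely by the Cauchy-Schwarz inequality. -/
structure IsDiffusionMeasureSpace {X 𝕜 : Type*} [RCLike 𝕜] [TopologicalSpace X]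
    [MeasurableSpace X] [BorelSpace X] (μ : Measure X) (ρ : X → X → ℝ)
    (φ : ℕ → X → 𝕜) (lam : ℕ → ℝ) (α : ℝ) : Prop where
  isProbabilityMeasure : IsProbabilityMeasure μ
  isQuasiMetric : IsQuasiMetric ρ
  continuous_phi : ∀ k, Continuous (φ k)
  phi_zero : ∀ x, φ 0 x = 1
  orthonormal_basis : ∃ b : HilbertBasis ℕ 𝕜 (Lp 𝕜 2 μ), ∀ k, b k =ᵐ[μ] φ k
  lam_zero : lam 0 = 0
  lam_mono : Monotone lam
  lam_tendsto : Tendsto lam atTop atTop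
  alpha_pos : 0 < α
  isCompact_closedBall : ∀ x t, 0 < t → IsCompact (closedBall ρ x t)
  volume_upper : ∃ C : ℝ, 0 < C ∧ ∀ x t, 0 < t → μ.real (closedBall ρ x t) ≤ C * t ^ α
  heat_upper : ∃ c C : ℝ, 0 < c ∧ 0 < C ∧ ∀ x y t, 0 < t → t ≤ 1 →
    ‖heatKernel φ lam t x y‖ ≤ C * t ^ (-(α / 2)) * Real.exp (-c * (ρ x y ^ 2 / t))
  heat_lower : ∃ c : ℝ, 0 < c ∧ ∀ x t, 0 < t → t < 1 →
    c * t ^ (-(α / 2)) ≤ RCLike.re (heatKernel φ lam t x x)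

/-- The space `Π_N` of diffusion polynomials of degree at most `N`. -/
def diffusionPolynomials {X 𝕜 : Type*} [RCLike 𝕜] (φ : ℕ → X → 𝕜) (lam : ℕ → ℝ) (N : ℝ) :
    Submodule 𝕜 (X → 𝕜) :=
  Submodule.span 𝕜 (φ '' {k | lam k ≤ N})

/-- The error `E(f, Π_N, L_p(ν))` of best approximation of `f` by diffusion polynomials in `Π_N`. -/
def bestApproxError {X 𝕜 : Type*} [RCLike 𝕜] [MeasurableSpace X] (φ : ℕ → X → 𝕜) (lam : ℕ → ℝ)
    (p : ℝ≥0∞) (ν : Measure X) (N : ℝ) (f : X → 𝕜) : ℝ≥0∞ :=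
  ⨅ g ∈ diffusionPolynomials φ lam N, eLpNorm (f - g) p ν

/-- The Sobolev norm `‖f‖_{L_p(ν)} + sup_N N^s E(f, Π_N, L_p(ν))`, where `N` runs through
the powers `2^n`, `n = 0, 1, 2, …`. -/
def sobolevNorm {X 𝕜 : Type*} [RCLike 𝕜] [MeasurableSpace X] (φ : ℕ → X → 𝕜) (lam : ℕ → ℝ)
    (s : ℝ) (p : ℝ≥0∞) (ν : Measure X) (f : X → 𝕜) : ℝ≥0∞ :=
  eLpNorm f p ν +
    ⨆ n : ℕ, ENNReal.ofReal (((2 : ℝ) ^ n) ^ s) * bestApproxError φ lam p ν ((2 : ℝ) ^ n) f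

/-- The ball of radius `r` of the Sobolev space of order `s`, as a subset of `L_p(ν)`. -/
def sobolevBall {X 𝕜 : Type*} [RCLike 𝕜] [MeasurableSpace X] (φ : ℕ → X → 𝕜) (lam : ℕ → ℝ)
    (s : ℝ) (p : ℝ≥0∞) (ν : Measure X) (r : ℝ) : Set (Lp 𝕜 p ν) :=
  {f | sobolevNorm φ lam s p ν f ≤ ENNReal.ofReal r}

/-- The minimal number of open balls of radius `ε`, with centers anywhere in `E`, that cover `Y`. -/
def openCoveringNumber {E : Type*} [PseudoMetricSpace E] (ε : ℝ) (Y : Set E) : ℕ∞ :=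
  ⨅ (C : Set E) (_ : Y ⊆ ⋃ g ∈ C, Metric.ball g ε), C.encard

/-- The metric entropy `H_ε(Y, E) = log₂ N_ε(Y)` of a compact set `Y` in `E`, where `N_ε` counts
open balls. For compact `Y` and `ε > 0` the covering number is finite. -/
def metricEntropy {E : Type*} [PseudoMetricSpace E] (ε : ℝ) (Y : Set E) : ℝ :=
  Real.logb 2 ((openCoveringNumber ε Y).toNat : ℝ)

/-- The same with closed balls of radius `ε` (Mathlib's `externalCoveringNumber`). -/
def closedMetricEntropy {E : Type*} [PseudoMetricSpace E] (ε : ℝ) (Y : Set E) : ℝ :=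
  Real.logb 2 ((Metric.externalCoveringNumber ε.toNNReal Y).toNat : ℝ)

end

end DiffusionSpace

/-!
The Sobolev ball is a ball of an approximation space: membership of `f` in it depends only on the
norm of `f` and on its distances to the finite-dimensional subspaces `V n` of classes in `L_p(B)` of
diffusion polynomials of degree at most `2 ^ n`. For such balls the metric entropy is governed by
the dimensions alone. If they are comparable with `2 ^ (nα)`, volume comparison in `V n`
gives the lower bound, because the ball contains all elements of `V n` of norm at most
`r / (1 + 2 ^ (ns))` (`mem_approximationBall_of_mem`, `two_pow_finrank_le_card_of_cover`). The upper
bound comes from refining a covering at scale `r / 2 ^ (ns)` to one at scale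
`r / 2 ^ ((n + 1)s)`, which multiplies its size by a factor exponential in `dim V (n + 1)`
(`exists_finset_cover_approximationBall`). The two constructions meet in
`entropy_approximationBall`.

It remains to show that `dim V n` is comparable with `2 ^ (nα)`. Since the `φ k` are bounded
functions, this dimension does not depend on `p` (`finrank_range_polynomialToLp_eq`). The upper
bound follows by integrating the on-diagonal bound for the heat kernel (`exists_card_le`). For the
lower bound, the restriction `L₂(μ) → L₂(B)` is a contraction, so that the trace
`∑ ∫_B |φ k|² dμ` over `λ_k ≤ 2 ^ n` is at most the rank `dim V n`
(`sum_norm_sq_le_finrank`, `sum_integral_norm_sq_le_finrank`). Pointwise the integrand is at least a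
constant times `2 ^ (nα)`, by the two-sided diagonal bounds for the heat kernel at two comparable
times (`exists_le_sum_norm_sq`). Hence `dim V n` is at least a constant times `μ(B) 2 ^ (nα)`, with
no localization of kernels involved. Off-diagonal decay of the heat kernel is needed only for
`μ(B) > 0` (`measure_openBall_pos`).
-/

namespace DiffusionSpace


/-! ### Nets and separated sets in finite-dimensional balls -/

section FiniteDimensional

open Module

variable {W : Type*} [NormedAddCommGroup W] [NormedSpace ℝ W] [FiniteDimensional ℝ W]

theorem card_le_of_separated_closedBall {R δ : ℝ} (hR : 0 ≤ R) (hδ : 0 < δ) (s : Finset W)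
    (hs : ∀ x ∈ s, ‖x‖ ≤ R) (hsep : ∀ x ∈ s, ∀ y ∈ s, x ≠ y → δ < dist x y) :
    (s.card : ℝ) ≤ (1 + 2 * R / δ) ^ finrank ℝ W := by
  borelize W
  let m : Measure W := Measure.addHaar
  have hdisj : (s : Set W).PairwiseDisjoint fun x => Metric.closedBall x (δ / 2) := by
    intro x hx y hy hxy
    exact Metric.closedBall_disjoint_closedBall (by linarith [hsep x hx y hy hxy])
  have hsub : (⋃ x ∈ s, Metric.closedBall x (δ / 2)) ⊆ Metric.closedBall (0 : W) (R + δ / 2) := by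
    refine iUnion₂_subset fun x hx => Metric.closedBall_subset_closedBall' ?_
    rw [dist_zero_right]
    linarith [hs x hx]
  have hm := measure_mono (μ := m) hsub
  rw [measure_biUnion_finset hdisj fun x _ => Metric.isClosed_closedBall.measurableSet] at hm
  simp_rw [Measure.addHaar_closedBall m _ (by positivity : 0 ≤ δ / 2)] at hm
  rw [Measure.addHaar_closedBall m _ (by positivity), Finset.sum_const, nsmul_eq_mul, ← mul_assoc,
    ENNReal.mul_le_mul_iff_left (Metric.measure_ball_pos m 0 one_pos).ne'
      Metric.isBounded_ball.measure_lt_top.ne,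
    ← ENNReal.ofReal_natCast, ← ENNReal.ofReal_mul (by positivity),
    ENNReal.ofReal_le_ofReal_iff (by positivity)] at hm
  have e : R + δ / 2 = (1 + 2 * R / δ) * (δ / 2) := by field_simp; ring
  rw [e, mul_pow] at hm
  exact le_of_mul_le_mul_right hm (by positivity)

/-- A maximal `δ`-separated subset of a ball is a `δ`-net. -/
theorem exists_net_closedBall {R δ : ℝ} (hR : 0 ≤ R) (hδ : 0 < δ) :
    ∃ T : Finset W, (T.card : ℝ) ≤ (1 + 2 * R / δ) ^ finrank ℝ W ∧
      Metric.closedBall (0 : W) R ⊆ ⋃ t ∈ T, Metric.closedBall t δ := by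
  classical
  by_contra! H
  have key : ∀ n : ℕ, ∃ s : Finset W, s.card = n ∧ (∀ x ∈ s, ‖x‖ ≤ R) ∧
      ∀ x ∈ s, ∀ y ∈ s, x ≠ y → δ < dist x y := by
    intro n
    induction n with
    | zero => exact ⟨∅, by simp⟩
    | succ n ih =>
      obtain ⟨s, hc, hs, hsep⟩ := ih
      have h := H s (card_le_of_separated_closedBall hR hδ s hs hsep)
      obtain ⟨x, hx, hxs⟩ := not_subset.1 h
      simp only [mem_iUnion, Metric.mem_closedBall, not_exists, not_le] at hxs
      have hxn : x ∉ s := fun h' => by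
        have := hxs x h'
        rw [dist_self] at this
        linarith
      refine ⟨insert x s, by rw [Finset.card_insert_of_notMem hxn, hc], ?_, ?_⟩
      · intro y hy
        rcases Finset.mem_insert.1 hy with rfl | hy
        · simpa using hx
        · exact hs y hy
      · intro y hy z hz hyz
        rw [Finset.mem_insert] at hy hz
        obtain hy | hy := hy <;> obtain hz | hz := hz
        · exact absurd (hy.trans hz.symm) hyz
        · exact hy ▸ hxs z hz
        · rw [dist_comm]; exact hz ▸ hxs y hy
        · exact hsep y hy z hz hyz
  obtain ⟨n, hn⟩ := exists_nat_gt ((1 + 2 * R / δ) ^ finrank ℝ W)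
  obtain ⟨s, hc, hs, hsep⟩ := key n
  have := card_le_of_separated_closedBall hR hδ s hs hsep
  rw [hc] at this
  linarith

end FiniteDimensional

section Subspace

open Module

variable {E : Type*} [NormedAddCommGroup E] [NormedSpace ℝ E]

theorem exists_net_inter_closedBall (V : Submodule ℝ E) [FiniteDimensional ℝ V] (f : E) {R δ : ℝ}
    (hR : 0 ≤ R) (hδ : 0 < δ) :
    ∃ T : Finset E, (T.card : ℝ) ≤ (1 + 4 * R / δ) ^ finrank ℝ V ∧
      (V : Set E) ∩ Metric.closedBall f R ⊆ ⋃ t ∈ T, Metric.closedBall t δ := by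
  classical
  by_cases hne : ((V : Set E) ∩ Metric.closedBall f R).Nonempty
  swap
  · refine ⟨∅, ?_, ?_⟩
    · simp only [Finset.card_empty, Nat.cast_zero]; positivity
    · simp [not_nonempty_iff_eq_empty.1 hne]
  obtain ⟨v, hvV, hv⟩ := hne
  obtain ⟨T, hT, hcov⟩ := exists_net_closedBall (W := V) (R := 2 * R) (by positivity) hδ
  refine ⟨T.image fun t : V => (t : E) + v, ?_, ?_⟩
  · refine le_trans (by exact_mod_cast Finset.card_image_le) (hT.trans_eq ?_)
    congr 2; ring
  · rintro g ⟨hgV, hg⟩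
    have h1 : (⟨g - v, V.sub_mem hgV hvV⟩ : V) ∈ Metric.closedBall (0 : V) (2 * R) := by
      rw [mem_closedBall_zero_iff, Submodule.coe_norm]
      change ‖g - v‖ ≤ _
      rw [← dist_eq_norm]
      have := dist_triangle_right g v f
      rw [Metric.mem_closedBall] at hv hg
      linarith
    obtain ⟨t, ht, hgt⟩ := mem_iUnion₂.1 (hcov h1)
    refine mem_iUnion₂.2 ⟨t + v, Finset.mem_image_of_mem (fun t : V => (t : E) + v) ht, ?_⟩
    rw [Metric.mem_closedBall, Subtype.dist_eq, dist_eq_norm] at hgt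
    rw [Metric.mem_closedBall, dist_eq_norm]
    convert hgt using 2
    simp; abel

/-- The centres need not lie in `V`: moving them there at most doubles the radius. -/
theorem two_pow_finrank_le_card_of_cover (V : Submodule ℝ E) [FiniteDimensional ℝ V] {ε : ℝ}
    (hε : 0 < ε) (T : Finset E)
    (hT : ∀ v ∈ V, ‖v‖ ≤ 4 * ε → ∃ t ∈ T, dist v t ≤ ε) : 2 ^ finrank ℝ V ≤ T.card := by
  classical
  borelize ↥V
  let m : Measure V := Measure.addHaar
  have hch : ∀ t : E, ∃ w : V, ∀ v : V, dist (v : E) t ≤ ε → dist v w ≤ 2 * ε := by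
    intro t
    by_cases h : ∃ w : V, dist (w : E) t ≤ ε
    · obtain ⟨w, hw⟩ := h
      refine ⟨w, fun v hv => ?_⟩
      rw [Subtype.dist_eq]
      linarith [dist_triangle_right (v : E) w t]
    · exact ⟨0, fun v hv => absurd ⟨v, hv⟩ h⟩
  choose w hw using hch
  have hsub : Metric.closedBall (0 : V) (4 * ε) ⊆ ⋃ t ∈ T, Metric.closedBall (w t) (2 * ε) := by
    intro v hv
    rw [mem_closedBall_zero_iff] at hv
    obtain ⟨t, ht, h⟩ := hT v v.2 hv
    exact mem_iUnion₂.2 ⟨t, ht, hw t v h⟩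
  have hm := (measure_mono (μ := m) hsub).trans (measure_biUnion_finset_le _ _)
  simp_rw [Measure.addHaar_closedBall m _ (by positivity : 0 ≤ 2 * ε)] at hm
  rw [Measure.addHaar_closedBall m _ (by positivity), Finset.sum_const, nsmul_eq_mul, ← mul_assoc,
    ENNReal.mul_le_mul_iff_left (Metric.measure_ball_pos m 0 one_pos).ne'
      Metric.isBounded_ball.measure_lt_top.ne,
    ← ENNReal.ofReal_natCast, ← ENNReal.ofReal_mul (by positivity),
    ENNReal.ofReal_le_ofReal_iff (by positivity)] at hm
  have e : 4 * ε = 2 * (2 * ε) := by ring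
  rw [e, mul_pow] at hm
  exact_mod_cast le_of_mul_le_mul_right hm (by positivity : 0 < (2 * ε) ^ finrank ℝ V)

end Subspace


/-! ### Metric entropy of balls of approximation spaces -/

section ApproximationSpace

open Module

variable {E : Type*} [NormedAddCommGroup E] [NormedSpace ℝ E]

/-- The ball of radius `r` of the approximation space of order `s` attached to subspaces `V n` of a
normed space `E`, where `V n` plays the role of the polynomials of degree at most `2 ^ n`. -/
def approximationBall (V : ℕ → Submodule ℝ E) (s r : ℝ) : Set E :=
  {f | ‖f‖ₑ + ⨆ n : ℕ, ENNReal.ofReal (((2 : ℝ) ^ n) ^ s) * Metric.infEDist f (V n) ≤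
    ENNReal.ofReal r}

variable {V : ℕ → Submodule ℝ E} {s r : ℝ}

theorem isClosed_approximationBall : IsClosed (approximationBall V s r) := by
  have : LowerSemicontinuous fun f : E => ‖f‖ₑ +
      ⨆ n : ℕ, ENNReal.ofReal (((2 : ℝ) ^ n) ^ s) * Metric.infEDist f (V n) := by
    refine continuous_enorm.lowerSemicontinuous.add (lowerSemicontinuous_iSup fun n => ?_)
    exact ((ENNReal.continuous_const_mul ENNReal.ofReal_ne_top).comp
      Metric.continuous_infEDist).lowerSemicontinuous
  exact this.isClosed_preimage _

theorem norm_le_of_mem_approximationBall (hr : 0 < r) {f : E} (hf : f ∈ approximationBall V s r) :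
    ‖f‖ ≤ r := by
  have h : ‖f‖ₑ ≤ ENNReal.ofReal r := le_self_add.trans hf
  rwa [← ofReal_norm, ENNReal.ofReal_le_ofReal_iff hr.le] at h

theorem exists_dist_lt_of_mem_approximationBall (hr : 0 < r) {f : E}
    (hf : f ∈ approximationBall V s r) (n : ℕ) :
    ∃ g ∈ V n, dist f g < 2 * r / ((2 : ℝ) ^ s) ^ n := by
  have hq : 0 < ((2 : ℝ) ^ s) ^ n := by positivity
  have h : ENNReal.ofReal (((2 : ℝ) ^ n) ^ s) * Metric.infEDist f (V n) ≤ ENNReal.ofReal r :=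
    (le_iSup (fun n : ℕ => ENNReal.ofReal (((2 : ℝ) ^ n) ^ s) * Metric.infEDist f (V n)) n).trans
      (le_add_self.trans hf)
  rw [← Real.rpow_pow_comm (by norm_num)] at h
  have h2 : Metric.infEDist f (V n) < ENNReal.ofReal (2 * r / ((2 : ℝ) ^ s) ^ n) := by
    by_contra! hc
    have h3 := (mul_le_mul_right hc (ENNReal.ofReal (((2 : ℝ) ^ s) ^ n))).trans h
    rw [← ENNReal.ofReal_mul hq.le, ENNReal.ofReal_le_ofReal_iff hr.le, mul_div_cancel₀ _ hq.ne']
      at h3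
    linarith
  obtain ⟨g, hg, hfg⟩ := Metric.infEDist_lt_iff.1 h2
  refine ⟨g, hg, ?_⟩
  rwa [edist_dist, ENNReal.ofReal_lt_ofReal_iff (by positivity)] at hfg

theorem mem_approximationBall_of_mem_zero (hV : Monotone V) {g : E} (hg : g ∈ V 0)
    (hgr : ‖g‖ ≤ r) : g ∈ approximationBall V s r := by
  have h0 : ∀ n, Metric.infEDist g (V n) = 0 := fun n =>
    Metric.infEDist_zero_of_mem (hV (Nat.zero_le n) hg)
  simp only [approximationBall, mem_ofPred_eq, h0, mul_zero, iSup_const, add_zero]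
  rw [← ofReal_norm]
  exact ENNReal.ofReal_le_ofReal hgr

/-- The Bernstein inequality: it is immediate here, since the error of approximation of an element
of `V n` vanishes from the index `n` on. -/
theorem mem_approximationBall_of_mem (hV : Monotone V) (hs : 0 < s) {n : ℕ} {g : E}
    (hg : g ∈ V n) (hgr : (1 + ((2 : ℝ) ^ s) ^ n) * ‖g‖ ≤ r) : g ∈ approximationBall V s r := by
  have h : (⨆ m : ℕ, ENNReal.ofReal (((2 : ℝ) ^ m) ^ s) * Metric.infEDist g (V m)) ≤
      ENNReal.ofReal (((2 : ℝ) ^ s) ^ n * ‖g‖) := by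
    refine iSup_le fun m => ?_
    rw [← Real.rpow_pow_comm (by norm_num), ENNReal.ofReal_mul (by positivity)]
    rcases le_total n m with hnm | hmn
    · rw [Metric.infEDist_zero_of_mem (hV hnm hg), mul_zero]
      exact zero_le
    · have h1 : Metric.infEDist g (V m) ≤ ENNReal.ofReal ‖g‖ := by
        refine (Metric.infEDist_le_edist_of_mem (V m).zero_mem).trans_eq ?_
        rw [edist_zero_right, ofReal_norm]
      gcongr
      exact Real.one_le_rpow (by norm_num) hs.le
  refine (add_le_add_right h _).trans ?_
  rw [← ofReal_norm, ← ENNReal.ofReal_add (norm_nonneg _) (by positivity)]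
  exact ENNReal.ofReal_le_ofReal (by linarith)

/-- The recursion over dyadic scales: an element of the approximation ball within `4r/2^{ns}` of
some `t` lies within `2r/2^{(n+1)s}` of a point of `V (n + 1)`, which is itself within a bounded
multiple of `r/2^{(n+1)s}` of `t`. Thus passing to the next scale costs a factor exponential in the
dimension of `V (n + 1)`, and these dimensions grow geometrically. -/
theorem exists_finset_cover_approximationBall [∀ n, FiniteDimensional ℝ (V n)] (hs : 0 < s)
    {α C : ℝ} (hα : 0 < α) (hC : 0 < C)
    (hdim : ∀ n, (finrank ℝ (V n) : ℝ) ≤ C * ((2 : ℝ) ^ α) ^ n) :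
    ∃ K : ℝ, 0 < K ∧ ∀ r : ℝ, 0 < r → ∀ n : ℕ, ∃ T : Finset E,
      (T.card : ℝ) ≤ 2 ^ (K * ((2 : ℝ) ^ α) ^ n) ∧
      approximationBall V s r ⊆ ⋃ t ∈ T, Metric.ball t (4 * r / ((2 : ℝ) ^ s) ^ n) := by
  classical
  have hq : 1 < (2 : ℝ) ^ α := Real.one_lt_rpow (by norm_num) hα
  have hy : 1 < (2 : ℝ) ^ s := Real.one_lt_rpow (by norm_num) hs
  set q := (2 : ℝ) ^ α
  set y := (2 : ℝ) ^ s
  set A : ℝ := 1 + 4 * (4 * y + 2)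
  have hA : 1 < A := by simp only [A]; linarith
  have hL : 0 < Real.logb 2 A := Real.logb_pos (by norm_num) hA
  have hAL : (2 : ℝ) ^ Real.logb 2 A = A := Real.rpow_logb (by norm_num) (by norm_num) (by linarith)
  set L := Real.logb 2 A
  have hq1 : 0 < q - 1 := by linarith
  refine ⟨L * C * q / (q - 1), by positivity, fun r hr n => ?_⟩
  set K := L * C * q / (q - 1) with hK
  have hKq : K * (q - 1) = L * C * q := by rw [hK]; field_simp
  have hKpos : 0 < K := by positivity
  induction n with
  | zero =>
    refine ⟨{0}, ?_, fun f hf => ?_⟩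
    · simpa using Real.one_le_rpow one_le_two hKpos.le
    · have := norm_le_of_mem_approximationBall hr hf
      simp only [Finset.mem_singleton, iUnion_iUnion_eq_left, pow_zero, div_one,
        mem_ball_zero_iff]
      linarith
  | succ n ih =>
    obtain ⟨T, hT, hcov⟩ := ih
    have hδ : 0 < r / y ^ (n + 1) := by positivity
    choose S hS hScov using fun t : E => exists_net_inter_closedBall (V (n + 1)) t
      (R := 4 * r / y ^ n + 2 * r / y ^ (n + 1)) (by positivity) hδ
    have hratio : 1 + 4 * (4 * r / y ^ n + 2 * r / y ^ (n + 1)) / (r / y ^ (n + 1)) = A := by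
      simp only [A]
      field_simp
      ring
    have hS' : ∀ t, ((S t).card : ℝ) ≤ 2 ^ (L * C * q ^ (n + 1)) := by
      intro t
      refine (hS t).trans ?_
      rw [hratio, ← Real.rpow_natCast, ← hAL, ← Real.rpow_mul (by norm_num)]
      refine Real.rpow_le_rpow_of_exponent_le one_le_two ?_
      rw [mul_assoc]
      exact mul_le_mul_of_nonneg_left (hdim _) hL.le
    refine ⟨T.biUnion S, ?_, fun f hf => ?_⟩
    · calc ((T.biUnion S).card : ℝ) ≤ ∑ t ∈ T, ((S t).card : ℝ) := by
            exact_mod_cast Finset.card_biUnion_le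
        _ ≤ T.card * 2 ^ (L * C * q ^ (n + 1)) := by
            rw [← nsmul_eq_mul]
            exact Finset.sum_le_card_nsmul _ _ _ fun t _ => hS' t
        _ ≤ 2 ^ (K * q ^ n) * 2 ^ (L * C * q ^ (n + 1)) := by gcongr
        _ = 2 ^ (K * q ^ (n + 1)) := by
            rw [← Real.rpow_add (by norm_num)]
            congr 1
            linear_combination -q ^ n * hKq
    · obtain ⟨t, ht, hft⟩ := mem_iUnion₂.1 (hcov hf)
      obtain ⟨g, hg, hfg⟩ := exists_dist_lt_of_mem_approximationBall hr hf (n + 1)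
      have hgt : g ∈ (V (n + 1) : Set E) ∩
          Metric.closedBall t (4 * r / y ^ n + 2 * r / y ^ (n + 1)) := by
        refine ⟨hg, ?_⟩
        rw [Metric.mem_ball] at hft
        rw [Metric.mem_closedBall]
        linarith [dist_triangle_left g t f]
      obtain ⟨u, hu, hgu⟩ := mem_iUnion₂.1 (hScov t hgt)
      refine mem_iUnion₂.2 ⟨u, Finset.mem_biUnion.2 ⟨t, ht, hu⟩, ?_⟩
      rw [Metric.mem_closedBall] at hgu
      rw [Metric.mem_ball]
      have e1 : 2 * r / y ^ (n + 1) = 2 * (r / y ^ (n + 1)) := by ring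
      have e2 : 4 * r / y ^ (n + 1) = 4 * (r / y ^ (n + 1)) := by ring
      rw [e1] at hfg
      rw [e2]
      linarith [dist_triangle f g u]

theorem isCompact_approximationBall [CompleteSpace E] [∀ n, FiniteDimensional ℝ (V n)]
    (hs : 0 < s) {α C : ℝ} (hα : 0 < α) (hC : 0 < C)
    (hdim : ∀ n, (finrank ℝ (V n) : ℝ) ≤ C * ((2 : ℝ) ^ α) ^ n) (hr : 0 < r) :
    IsCompact (approximationBall V s r) := by
  refine isCompact_iff_totallyBounded_isComplete.2
    ⟨?_, isClosed_approximationBall.isComplete⟩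
  obtain ⟨K, -, hcov⟩ := exists_finset_cover_approximationBall hs hα hC hdim
  refine Metric.totallyBounded_iff.2 fun ε hε => ?_
  obtain ⟨n, hn⟩ := pow_unbounded_of_one_lt (4 * r / ε) (Real.one_lt_rpow one_lt_two hs)
  obtain ⟨T, -, hT⟩ := hcov r hr n
  refine ⟨T, T.finite_toSet, hT.trans (iUnion₂_mono fun t _ => Metric.ball_subset_ball ?_)⟩
  rw [div_lt_iff₀ hε] at hn
  rw [div_le_iff₀ (by positivity)]
  linarith

theorem externalCoveringNumber_le_openCoveringNumber {F : Type*} [PseudoMetricSpace F] {ε : ℝ}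
    (hε : 0 ≤ ε) (Y : Set F) :
    Metric.externalCoveringNumber ε.toNNReal Y ≤ openCoveringNumber ε Y := by
  refine le_iInf₂ fun S hS => Metric.IsCover.externalCoveringNumber_le_encard ?_
  rw [Metric.isCover_iff_subset_iUnion_closedBall, Real.coe_toNNReal _ hε]
  exact hS.trans (iUnion₂_mono fun t _ => Metric.ball_subset_closedBall)

theorem two_pow_finrank_le_externalCoveringNumber [∀ n, FiniteDimensional ℝ (V n)]
    (hV : Monotone V) (hs : 0 < s) {ε : ℝ} (hε : 0 < ε) {n : ℕ}
    (hn : (1 + ((2 : ℝ) ^ s) ^ n) * (4 * ε) ≤ r) :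
    ((2 ^ finrank ℝ (V n) : ℕ) : ℕ∞) ≤
      Metric.externalCoveringNumber ε.toNNReal (approximationBall V s r) := by
  refine le_iInf₂ fun S hS => ?_
  rw [Metric.isCover_iff_subset_iUnion_closedBall, Real.coe_toNNReal _ hε.le] at hS
  rcases S.finite_or_infinite with hfin | hinf
  · lift S to Finset E using hfin
    rw [encard_coe_eq_coe_finsetCard, Nat.cast_le]
    refine two_pow_finrank_le_card_of_cover (V n) hε S fun v hv hvε => ?_
    obtain ⟨t, ht, h⟩ := mem_iUnion₂.1 (hS (mem_approximationBall_of_mem hV hs hv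
      ((mul_le_mul_of_nonneg_left hvε (by positivity)).trans hn)))
    exact ⟨t, ht, h⟩
  · rw [hinf.encard_eq]
    exact le_top

/-- The approximation ball contains antipodal points at distance `2r`, so two balls of radius less
than `r` are needed to cover it, and two open balls also at radius `r`. -/
theorem two_le_encard_of_cover (hV : Monotone V) (hV0 : V 0 ≠ ⊥) (hr : 0 < r) (S : Set E)
    {P : E → E → Prop} (hP : ∀ t f g, P t f → P t g → dist f g < 2 * r)
    (hS : ∀ f ∈ approximationBall V s r, ∃ t ∈ S, P t f) : 2 ≤ S.encard := by
  obtain ⟨v, hv, hv0⟩ := Submodule.exists_mem_ne_zero_of_ne_bot hV0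
  set g : E := (r / ‖v‖) • v
  have hg : ‖g‖ = r := by
    rw [norm_smul, norm_div, norm_norm, Real.norm_of_nonneg hr.le,
      div_mul_cancel₀ _ (norm_ne_zero_iff.2 hv0)]
  have hgV : g ∈ V 0 := (V 0).smul_mem _ hv
  obtain ⟨a, ha, hag⟩ := hS g (mem_approximationBall_of_mem_zero hV hgV hg.le)
  obtain ⟨b, hb, hbg⟩ := hS (-g) (mem_approximationBall_of_mem_zero hV ((V 0).neg_mem hgV)
    (by rw [norm_neg, hg]))
  by_contra! hlt
  have hle : S.encard ≤ 1 := by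
    rw [← ENat.lt_add_one_iff (by simp)]
    exact hlt
  rw [← encard_le_one_iff.1 hle a b ha hb] at hbg
  have := hP a _ _ hag hbg
  rw [dist_eq_norm, sub_neg_eq_add, ← two_smul ℝ g, norm_smul, hg, Real.norm_two] at this
  exact lt_irrefl _ this

theorem two_le_openCoveringNumber (hV : Monotone V) (hV0 : V 0 ≠ ⊥) {ε : ℝ} (hε : 0 < ε)
    (hεr : ε ≤ r) : 2 ≤ openCoveringNumber ε (approximationBall V s r) := by
  refine le_iInf₂ fun S hS => two_le_encard_of_cover (s := s) hV hV0 (hε.trans_le hεr) S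
    (P := fun t f => dist f t < ε) (fun t f g hf hg => ?_) fun f hf => ?_
  · linarith [dist_triangle_right f g t]
  · obtain ⟨t, ht, h⟩ := mem_iUnion₂.1 (hS hf)
    exact ⟨t, ht, h⟩

theorem two_le_externalCoveringNumber (hV : Monotone V) (hV0 : V 0 ≠ ⊥) {ε : ℝ} (hε : 0 < ε)
    (hεr : ε < r) :
    2 ≤ Metric.externalCoveringNumber ε.toNNReal (approximationBall V s r) := by
  refine le_iInf₂ fun S hS => two_le_encard_of_cover (s := s) hV hV0 (hε.trans hεr) S
    (P := fun t f => dist f t ≤ ε) (fun t f g hf hg => ?_) fun f hf => ?_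
  · linarith [dist_triangle_right f g t]
  · rw [Metric.isCover_iff_subset_iUnion_closedBall, Real.coe_toNNReal _ hε.le] at hS
    obtain ⟨t, ht, h⟩ := mem_iUnion₂.1 (hS hf)
    exact ⟨t, ht, h⟩

theorem two_rpow_pow_eq {s : ℝ} (hs : 0 < s) (α : ℝ) (n : ℕ) :
    ((2 : ℝ) ^ α) ^ n = (((2 : ℝ) ^ s) ^ n) ^ (α / s) := by
  rw [Real.rpow_pow_comm (by norm_num), Real.rpow_pow_comm (by norm_num),
    ← Real.rpow_mul (by positivity), mul_div_cancel₀ _ hs.ne']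

/-- Two-sided entropy bounds for approximation balls: only the dimensions of the approximating
subspaces matter. -/
theorem entropy_approximationBall [∀ n, FiniteDimensional ℝ (V n)] (hV : Monotone V)
    (hV0 : V 0 ≠ ⊥) (hs : 0 < s) {α c₁ C₁ : ℝ} (hα : 0 < α) (hc₁ : 0 < c₁) (hC₁ : 0 < C₁)
    (hlow : ∀ n, c₁ * ((2 : ℝ) ^ α) ^ n ≤ finrank ℝ (V n))
    (hdim : ∀ n, (finrank ℝ (V n) : ℝ) ≤ C₁ * ((2 : ℝ) ^ α) ^ n) :
    ∃ c C : ℝ, 0 < c ∧ 0 < C ∧ ∀ ε r : ℝ, 0 < ε → ε ≤ r →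
      (c * (r / ε) ^ (α / s) ≤ metricEntropy ε (approximationBall V s r) ∧
        metricEntropy ε (approximationBall V s r) ≤ C * (r / ε) ^ (α / s)) ∧
      (ε < r → c * (r / ε) ^ (α / s) ≤ closedMetricEntropy ε (approximationBall V s r) ∧
        closedMetricEntropy ε (approximationBall V s r) ≤ C * (r / ε) ^ (α / s)) := by
  obtain ⟨K, hK, hcov⟩ := exists_finset_cover_approximationBall hs hα hC₁ hdim
  have hq : 0 < (2 : ℝ) ^ α := by positivity
  have hy : 1 < (2 : ℝ) ^ s := Real.one_lt_rpow one_lt_two hs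
  set β := α / s with hβ
  have hβ0 : 0 < β := by positivity
  refine ⟨min 1 (c₁ / 2 ^ α) / 8 ^ β, K * 2 ^ α * 4 ^ β, by positivity, by positivity,
    fun ε r hε hεr => ?_⟩
  have hr : 0 < r := hε.trans_le hεr
  have hx : 1 ≤ r / ε := (one_le_div hε).2 hεr
  have hx0 : 0 < r / ε := by positivity
  -- Upper bound, from the covering at the first dyadic scale below `ε`.
  obtain ⟨T, hTcard, hT⟩ : ∃ T : Finset E, (T.card : ℝ) ≤ 2 ^ (K * 2 ^ α * 4 ^ β * (r / ε) ^ β) ∧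
      approximationBall V s r ⊆ ⋃ t ∈ T, Metric.ball t ε := by
    obtain ⟨n, hn, hn'⟩ := exists_nat_pow_near (by linarith : 1 ≤ 4 * (r / ε)) hy
    obtain ⟨T, hTcard, hT⟩ := hcov r hr (n + 1)
    refine ⟨T, hTcard.trans (Real.rpow_le_rpow_of_exponent_le one_le_two ?_),
      hT.trans (iUnion₂_mono fun t _ => Metric.ball_subset_ball ?_)⟩
    · rw [pow_succ, two_rpow_pow_eq hs α n, mul_assoc K, mul_assoc K, mul_assoc, mul_comm _ (2 ^ α),
        ← Real.mul_rpow (by norm_num) hx0.le]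
      gcongr
    · rw [div_le_iff₀ (by positivity)]
      have : 4 * r = ε * (4 * (r / ε)) := by field_simp
      rw [this]
      gcongr
  have hupper : openCoveringNumber ε (approximationBall V s r) ≤ T.card := by
    rw [← encard_coe_eq_coe_finsetCard]
    exact iInf₂_le (T : Set E) hT
  -- Lower bound, valid for both kinds of balls.
  have hlower : ∀ N : ℕ∞, N ≤ openCoveringNumber ε (approximationBall V s r) →
      Metric.externalCoveringNumber ε.toNNReal (approximationBall V s r) ≤ N → 2 ≤ N →
      min 1 (c₁ / 2 ^ α) / 8 ^ β * (r / ε) ^ β ≤ Real.logb 2 (N.toNat : ℝ) ∧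
        Real.logb 2 (N.toNat : ℝ) ≤ K * 2 ^ α * 4 ^ β * (r / ε) ^ β := by
    intro N hN hN' h2
    lift N to ℕ using ne_top_of_le_ne_top (ENat.natCast_ne_top _) (hN.trans hupper)
    rw [ENat.toNat_natCast]
    have hNT : N ≤ T.card := by exact_mod_cast hN.trans hupper
    have h2' : 2 ≤ N := by exact_mod_cast h2
    have hN0 : (0 : ℝ) < N := by positivity
    refine ⟨?_, ?_⟩
    · have e : min 1 (c₁ / 2 ^ α) / 8 ^ β * (r / ε) ^ β =
          min 1 (c₁ / 2 ^ α) * (r / ε / 8) ^ β := by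
        rw [Real.div_rpow hx0.le (by norm_num)]; ring
      rw [e, Real.le_logb_iff_rpow_le one_lt_two hN0]
      rcases lt_or_ge (r / ε / 8) 1 with h8 | h8
      · calc (2 : ℝ) ^ (min 1 (c₁ / 2 ^ α) * (r / ε / 8) ^ β) ≤ 2 ^ (1 : ℝ) := by
              refine Real.rpow_le_rpow_of_exponent_le one_le_two ?_
              exact mul_le_one₀ (min_le_left _ _) (by positivity)
                (Real.rpow_le_one (by positivity) h8.le hβ0.le)
          _ ≤ N := by rw [Real.rpow_one]; exact_mod_cast h2'
      · obtain ⟨n, hn, hn'⟩ := exists_nat_pow_near h8 hy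
        have hnε : (1 + ((2 : ℝ) ^ s) ^ n) * (4 * ε) ≤ r := by
          have h1 : 1 ≤ ((2 : ℝ) ^ s) ^ n := one_le_pow₀ hy.le
          rw [div_div, le_div_iff₀ (by positivity)] at hn
          nlinarith
        have hD := (two_pow_finrank_le_externalCoveringNumber hV hs hε hnε).trans hN'
        have hD' : 2 ^ finrank ℝ (V n) ≤ N := by exact_mod_cast hD
        calc (2 : ℝ) ^ (min 1 (c₁ / 2 ^ α) * (r / ε / 8) ^ β)
            ≤ 2 ^ (finrank ℝ (V n) : ℝ) := by
              refine Real.rpow_le_rpow_of_exponent_le one_le_two (le_trans ?_ (hlow n))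
              calc min 1 (c₁ / 2 ^ α) * (r / ε / 8) ^ β
                  ≤ c₁ / 2 ^ α * (((2 : ℝ) ^ s) ^ (n + 1)) ^ β := by
                    gcongr
                    exact min_le_right _ _
                _ = c₁ * ((2 : ℝ) ^ α) ^ n := by
                    rw [← two_rpow_pow_eq hs α (n + 1), pow_succ]
                    field_simp
          _ ≤ N := by rw [Real.rpow_natCast]; exact_mod_cast hD'
    · rw [Real.logb_le_iff_le_rpow one_lt_two hN0]
      exact le_trans (by exact_mod_cast hNT) hTcard
  have hle := externalCoveringNumber_le_openCoveringNumber hε.le (approximationBall V s r)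
  exact ⟨hlower _ le_rfl hle (two_le_openCoveringNumber hV hV0 hε hεr),
    fun h => hlower _ hle le_rfl (two_le_externalCoveringNumber hV hV0 hε h)⟩

end ApproximationSpace


/-! ### The trace of a contraction -/

section Trace

open Module

/-- The trace of a positive contraction is at most its rank. -/
theorem sum_norm_sq_le_finrank {𝕜 H K ι : Type*} [RCLike 𝕜] [NormedAddCommGroup H]
    [InnerProductSpace 𝕜 H] [CompleteSpace H] [NormedAddCommGroup K] [InnerProductSpace 𝕜 K]
    [CompleteSpace K] (T : H →L[𝕜] K) (hT : ‖T‖ ≤ 1) {v : ι → H} (hv : Orthonormal 𝕜 v)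
    (F : Finset ι) (S : Submodule 𝕜 K) [FiniteDimensional 𝕜 S] (hS : ∀ k ∈ F, T (v k) ∈ S) :
    ∑ k ∈ F, ‖T (v k)‖ ^ 2 ≤ finrank 𝕜 S := by
  set e := stdOrthonormalBasis 𝕜 S
  have h1 : ∀ k ∈ F, ‖T (v k)‖ ^ 2 =
      ∑ j, ‖inner 𝕜 (v k) (ContinuousLinearMap.adjoint T (e j : K))‖ ^ 2 := by
    intro k hk
    have h := e.sum_sq_norm_inner_right ⟨T (v k), hS k hk⟩
    rw [Submodule.coe_norm] at h
    rw [← h]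
    refine Finset.sum_congr rfl fun j _ => ?_
    rw [ContinuousLinearMap.adjoint_inner_right, Submodule.coe_inner, norm_inner_symm]
  rw [Finset.sum_congr rfl h1, Finset.sum_comm]
  have h2 : ∀ j, ∑ k ∈ F, ‖inner 𝕜 (v k) (ContinuousLinearMap.adjoint T (e j : K))‖ ^ 2 ≤ 1 := by
    intro j
    refine (hv.sum_inner_products_le _).trans ?_
    have h3 : ‖ContinuousLinearMap.adjoint T (e j : K)‖ ≤ 1 := by
      refine (ContinuousLinearMap.le_opNorm _ _).trans ?_
      rw [LinearIsometryEquiv.norm_map]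
      have : ‖(e j : K)‖ = 1 := by rw [← Submodule.coe_norm, e.orthonormal.1 j]
      rw [this, mul_one]
      exact hT
    exact pow_le_one₀ (norm_nonneg _) h3
  refine (Finset.sum_le_sum fun j _ => h2 j).trans ?_
  simp

end Trace

theorem norm_sq_eq_integral {X 𝕜 : Type*} [RCLike 𝕜] [MeasurableSpace X] {ν : Measure X}
    (f : Lp 𝕜 2 ν) {g : X → 𝕜} (h : f =ᵐ[ν] g) : ‖f‖ ^ 2 = ∫ x, ‖g x‖ ^ 2 ∂ν := by
  have h1 : ((‖f‖ ^ 2 : ℝ) : 𝕜) = ((∫ x, ‖f x‖ ^ 2 ∂ν : ℝ) : 𝕜) := by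
    rw [RCLike.ofReal_pow, ← inner_self_eq_norm_sq_to_K, L2.inner_def, ← integral_ofReal]
    simp_rw [inner_self_eq_norm_sq_to_K, RCLike.ofReal_pow]
  rw [RCLike.ofReal_inj.1 h1]
  exact integral_congr_ae (h.mono fun x hx => by simp only [hx])

/-! ### Diagonal heat kernel bounds and spectral sums -/

section HeatKernel

variable {X 𝕜 : Type*} [RCLike 𝕜]

theorem heatKernel_self (φ : ℕ → X → 𝕜) (lam : ℕ → ℝ) (t : ℝ) (x : X) :
    heatKernel φ lam t x x =
      ((∑' k, Real.exp (-(lam k) ^ 2 * t) * ‖φ k x‖ ^ 2 : ℝ) : 𝕜) := by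
  rw [RCLike.ofReal_tsum, heatKernel]
  refine tsum_congr fun k => ?_
  rw [mul_assoc, RCLike.mul_conj]
  push_cast
  rfl

variable [TopologicalSpace X] [MeasurableSpace X] [BorelSpace X] {μ : Measure X} {ρ : X → X → ℝ}
  {φ : ℕ → X → 𝕜} {lam : ℕ → ℝ} {α : ℝ}

namespace IsDiffusionMeasureSpace

variable (h : IsDiffusionMeasureSpace μ ρ φ lam α)

include h

theorem finite_setOf_lam_le (N : ℝ) : {k | lam k ≤ N}.Finite := by
  have h1 := h.lam_tendsto.eventually_gt_atTop N
  rw [← Nat.cofinite_eq_atTop] at h1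
  simpa using h1

/-- A divergent diagonal series would make the heat kernel vanish there, against the lower bound. -/
theorem summable_heatKernel_self (x : X) {t : ℝ} (ht : 0 < t) (ht1 : t < 1) :
    Summable fun k => Real.exp (-(lam k) ^ 2 * t) * ‖φ k x‖ ^ 2 := by
  obtain ⟨c, hc, hlow⟩ := h.heat_lower
  by_contra hns
  have := hlow x t ht ht1
  rw [heatKernel_self, tsum_eq_zero_of_not_summable hns] at this
  simp only [map_zero] at this
  have h2 : 0 < c * t ^ (-(α / 2)) := by positivity
  linarith

theorem exists_le_tsum : ∃ c : ℝ, 0 < c ∧ ∀ x t, 0 < t → t < 1 →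
    c * t ^ (-(α / 2)) ≤ ∑' k, Real.exp (-(lam k) ^ 2 * t) * ‖φ k x‖ ^ 2 := by
  obtain ⟨c, hc, hlow⟩ := h.heat_lower
  refine ⟨c, hc, fun x t ht ht1 => ?_⟩
  have := hlow x t ht ht1
  rwa [heatKernel_self, RCLike.ofReal_re] at this

theorem exists_sum_le : ∃ C : ℝ, 0 < C ∧ ∀ x t, 0 < t → t < 1 → ∀ F : Finset ℕ,
    ∑ k ∈ F, Real.exp (-(lam k) ^ 2 * t) * ‖φ k x‖ ^ 2 ≤ C * t ^ (-(α / 2)) := by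
  obtain ⟨c, C, hc, hC, hup⟩ := h.heat_upper
  refine ⟨C, hC, fun x t ht ht1 F => ?_⟩
  have h1 := hup x x t ht ht1.le
  rw [(h.isQuasiMetric.eq_zero_iff x x).2 rfl, heatKernel_self] at h1
  simp only [ne_eq, OfNat.ofNat_ne_zero, not_false_eq_true, zero_pow, zero_div, mul_zero,
    Real.exp_zero, mul_one, RCLike.norm_ofReal] at h1
  exact ((h.summable_heatKernel_self x ht ht1).sum_le_tsum F fun k _ => by positivity).trans
    ((le_abs_self _).trans h1)

theorem exists_norm_le (k : ℕ) : ∃ M : ℝ, ∀ x, ‖φ k x‖ ≤ M := by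
  obtain ⟨C, hC, hup⟩ := h.exists_sum_le
  refine ⟨√(C * (1 / 2 : ℝ) ^ (-(α / 2)) / Real.exp (-(lam k) ^ 2 * (1 / 2))), fun x => ?_⟩
  have := hup x (1 / 2) (by norm_num) (by norm_num) {k}
  rw [Finset.sum_singleton] at this
  refine Real.le_sqrt_of_sq_le ?_
  rw [le_div_iff₀ (Real.exp_pos _)]
  linarith

theorem memLp (k : ℕ) (p : ℝ≥0∞) (ν : Measure X) [IsFiniteMeasure ν] : MemLp (φ k) p ν := by
  obtain ⟨M, hM⟩ := h.exists_norm_le k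
  exact MemLp.of_bound (h.continuous_phi k).aestronglyMeasurable M (ae_of_all _ hM)

theorem integrable_norm_sq (k : ℕ) (ν : Measure X) [IsFiniteMeasure ν] :
    Integrable (fun x => ‖φ k x‖ ^ 2) ν :=
  (memLp_two_iff_integrable_sq_norm (h.continuous_phi k).aestronglyMeasurable).1 (h.memLp k 2 ν)

theorem integral_norm_sq (k : ℕ) : ∫ x, ‖φ k x‖ ^ 2 ∂μ = 1 := by
  obtain ⟨b, hb⟩ := h.orthonormal_basis
  rw [← norm_sq_eq_integral (b k) (hb k), b.orthonormal.1 k, one_pow]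

/-- Integrating the diagonal bound for the heat kernel at time `2^{-2n}/2` counts the eigenvalues
up to `2^n`. -/
theorem exists_card_le : ∃ C : ℝ, 0 < C ∧ ∀ n : ℕ,
    ((h.finite_setOf_lam_le ((2 : ℝ) ^ n)).toFinset.card : ℝ) ≤ C * ((2 : ℝ) ^ α) ^ n := by
  have := h.isProbabilityMeasure
  obtain ⟨C, hC, hup⟩ := h.exists_sum_le
  refine ⟨Real.exp 1 * (C * (1 / 2 : ℝ) ^ (-(α / 2))), by positivity, fun n => ?_⟩
  set F := (h.finite_setOf_lam_le ((2 : ℝ) ^ n)).toFinset with hF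
  have h1n : (1 : ℝ) ≤ (2 : ℝ) ^ n := one_le_pow₀ one_le_two
  set t : ℝ := 1 / 2 * ((2 : ℝ) ^ n) ^ (-2 : ℝ) with ht
  have hpow : ((2 : ℝ) ^ n) ^ (-2 : ℝ) = (((2 : ℝ) ^ n) ^ 2)⁻¹ := by
    rw [Real.rpow_neg (by positivity), ← Real.rpow_natCast _ 2]; norm_num
  have ht0 : 0 < t := by positivity
  have ht1 : t < 1 := by
    have : ((2 : ℝ) ^ n) ^ (-2 : ℝ) ≤ 1 := Real.rpow_le_one_of_one_le_of_nonpos h1n (by norm_num)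
    linarith
  have htα : t ^ (-(α / 2)) = (1 / 2 : ℝ) ^ (-(α / 2)) * ((2 : ℝ) ^ α) ^ n := by
    rw [ht, Real.mul_rpow (by norm_num) (by positivity), ← Real.rpow_mul (by positivity),
      Real.rpow_pow_comm (by norm_num)]
    congr 2; ring
  have hint : ∑ k ∈ F, Real.exp (-(lam k) ^ 2 * t) ≤ C * t ^ (-(α / 2)) := by
    calc ∑ k ∈ F, Real.exp (-(lam k) ^ 2 * t)
        = ∫ x, ∑ k ∈ F, Real.exp (-(lam k) ^ 2 * t) * ‖φ k x‖ ^ 2 ∂μ := by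
          rw [integral_finsetSum _ fun k _ => (h.integrable_norm_sq k μ).const_mul _]
          simp_rw [integral_const_mul, h.integral_norm_sq, mul_one]
      _ ≤ ∫ x, C * t ^ (-(α / 2)) ∂μ := by
          refine integral_mono (integrable_finsetSum _ fun k _ =>
            (h.integrable_norm_sq k μ).const_mul _) (integrable_const _) fun x => hup x t ht0 ht1 F
      _ = C * t ^ (-(α / 2)) := by simp
  have hcard : (F.card : ℝ) * Real.exp (-1) ≤ ∑ k ∈ F, Real.exp (-(lam k) ^ 2 * t) := by
    rw [← nsmul_eq_mul]
    refine Finset.card_nsmul_le_sum _ _ _ fun k hk => Real.exp_le_exp.2 ?_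
    have hk' : lam k ≤ 2 ^ n := by simpa [hF] using hk
    have hk0 : 0 ≤ lam k := h.lam_zero ▸ h.lam_mono (Nat.zero_le k)
    have h2 : (lam k) ^ 2 ≤ ((2 : ℝ) ^ n) ^ 2 := pow_le_pow_left₀ hk0 hk' 2
    have h3 : (lam k) ^ 2 * ((2 : ℝ) ^ n) ^ (-2 : ℝ) ≤ 1 := by
      rw [hpow, ← div_eq_mul_inv]
      exact div_le_one_of_le₀ h2 (by positivity)
    have h4 : -(lam k) ^ 2 * t = -(1 / 2 * ((lam k) ^ 2 * ((2 : ℝ) ^ n) ^ (-2 : ℝ))) := by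
      rw [ht]; ring
    rw [h4]
    linarith
  have h5 := hcard.trans hint
  rw [htα, Real.exp_neg, ← div_eq_mul_inv, div_le_iff₀ (Real.exp_pos _)] at h5
  linarith

/-- The diagonal of the heat kernel at a time `A / N ^ 2`, with `A` a large constant, is dominated
by the eigenvalues up to `N`, since the other ones contribute at most `exp (-A / 2)` times the
kernel at half the time. -/
theorem exists_le_sum_norm_sq : ∃ c : ℝ, 0 < c ∧ ∀ (n : ℕ) (x : X), c * ((2 : ℝ) ^ α) ^ n ≤
    ∑ k ∈ (h.finite_setOf_lam_le ((2 : ℝ) ^ n)).toFinset, ‖φ k x‖ ^ 2 := by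
  obtain ⟨c, hc, hlow⟩ := h.exists_le_tsum
  obtain ⟨C, hC, hup⟩ := h.exists_sum_le
  obtain ⟨A, hA0, hA⟩ : ∃ A : ℝ, 0 < A ∧
      Real.exp (-(A / 2)) * (C * (1 / 2 : ℝ) ^ (-(α / 2))) ≤ c / 2 := by
    have ht : Tendsto (fun A : ℝ => Real.exp (-(A / 2)) * (C * (1 / 2 : ℝ) ^ (-(α / 2)))) atTop
        (𝓝 (0 * (C * (1 / 2 : ℝ) ^ (-(α / 2))))) :=
      (Real.tendsto_exp_neg_atTop_nhds_zero.comp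
        (tendsto_id.atTop_div_const two_pos)).mul_const _
    rw [zero_mul] at ht
    obtain ⟨A, hA, hA'⟩ := ((eventually_gt_atTop 0).and
      (ht.eventually_le_const (half_pos hc))).exists
    exact ⟨A, hA, hA'⟩
  refine ⟨min 1 (c / 2) * A ^ (-(α / 2)), by positivity, fun n x => ?_⟩
  set F := (h.finite_setOf_lam_le ((2 : ℝ) ^ n)).toFinset with hF
  set N : ℝ := (2 : ℝ) ^ n
  have hN : 0 < N := by positivity
  set t : ℝ := A * N ^ (-2 : ℝ) with ht
  have hpow : N ^ (-2 : ℝ) = (N ^ 2)⁻¹ := by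
    rw [Real.rpow_neg (by positivity), ← Real.rpow_natCast _ 2]; norm_num
  have ht0 : 0 < t := by positivity
  have hNt : N ^ 2 * t = A := by rw [ht, hpow]; field_simp
  have htα : t ^ (-(α / 2)) = A ^ (-(α / 2)) * ((2 : ℝ) ^ α) ^ n := by
    rw [ht, Real.mul_rpow hA0.le (by positivity), ← Real.rpow_mul (by positivity),
      Real.rpow_pow_comm (by norm_num)]
    congr 2; ring
  rw [mul_assoc, ← htα]
  rcases lt_or_ge t 1 with ht1 | ht1
  · have hthalf : (t / 2) ^ (-(α / 2)) = (1 / 2 : ℝ) ^ (-(α / 2)) * t ^ (-(α / 2)) := by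
      rw [← Real.mul_rpow (by norm_num) ht0.le]; congr 1; ring
    have key : ∑' k, Real.exp (-(lam k) ^ 2 * t) * ‖φ k x‖ ^ 2 ≤
        ∑ k ∈ F, ‖φ k x‖ ^ 2 + Real.exp (-(A / 2)) * (C * (t / 2) ^ (-(α / 2))) := by
      refine (h.summable_heatKernel_self x ht0 ht1).tsum_le_of_sum_le fun G => ?_
      have hterm : ∀ k ∈ G, Real.exp (-(lam k) ^ 2 * t) * ‖φ k x‖ ^ 2 ≤
          (if k ∈ F then ‖φ k x‖ ^ 2 else 0) +
            Real.exp (-(A / 2)) * (Real.exp (-(lam k) ^ 2 * (t / 2)) * ‖φ k x‖ ^ 2) := by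
        intro k _
        split_ifs with hk
        · have h1 : Real.exp (-(lam k) ^ 2 * t) ≤ 1 :=
            Real.exp_le_one_iff.2 (by nlinarith [sq_nonneg (lam k)])
          have h2 : Real.exp (-(lam k) ^ 2 * t) * ‖φ k x‖ ^ 2 ≤ ‖φ k x‖ ^ 2 :=
            mul_le_of_le_one_left (by positivity) h1
          have h3 : 0 ≤ Real.exp (-(A / 2)) *
            (Real.exp (-(lam k) ^ 2 * (t / 2)) * ‖φ k x‖ ^ 2) := by positivity
          linarith
        · have hk' : N < lam k := by simpa [hF] using hk
          rw [zero_add, ← mul_assoc (Real.exp (-(A / 2))), ← Real.exp_add]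
          refine mul_le_mul_of_nonneg_right (Real.exp_le_exp.2 ?_) (by positivity)
          have h1 : N ^ 2 ≤ (lam k) ^ 2 := pow_le_pow_left₀ hN.le hk'.le 2
          have h2 : A ≤ (lam k) ^ 2 * t := by
            rw [← hNt]; exact mul_le_mul_of_nonneg_right h1 ht0.le
          linarith
      refine (Finset.sum_le_sum hterm).trans ?_
      rw [Finset.sum_add_distrib, ← Finset.mul_sum]
      refine add_le_add ?_ (mul_le_mul_of_nonneg_left
        (hup x (t / 2) (by linarith) (by linarith) G) (Real.exp_pos _).le)
      rw [← Finset.sum_filter]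
      refine Finset.sum_le_sum_of_subset_of_nonneg (fun k hk => (Finset.mem_filter.1 hk).2)
        fun _ _ _ => by positivity
    have h1 := (hlow x t ht0 ht1).trans key
    rw [hthalf] at h1
    have h2 := mul_le_mul_of_nonneg_right hA (by positivity : 0 ≤ t ^ (-(α / 2)))
    have h3 := mul_le_mul_of_nonneg_right (min_le_right 1 (c / 2))
      (by positivity : 0 ≤ t ^ (-(α / 2)))
    nlinarith
  · -- For small `N` the constant function `φ 0 = 1` is enough.
    have h1 : t ^ (-(α / 2)) ≤ 1 :=
      Real.rpow_le_one_of_one_le_of_nonpos ht1 (by linarith [h.alpha_pos])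
    have h0 : (0 : ℕ) ∈ F := by
      simp only [hF, Finite.mem_toFinset, mem_ofPred_eq, h.lam_zero]
      exact hN.le
    have h2 : ‖φ 0 x‖ ^ 2 ≤ ∑ k ∈ F, ‖φ k x‖ ^ 2 :=
      Finset.single_le_sum (f := fun k => ‖φ k x‖ ^ 2) (fun _ _ => by positivity) h0
    rw [h.phi_zero, norm_one, one_pow] at h2
    exact (mul_le_one₀ (min_le_left _ _) (by positivity) h1).trans h2

end IsDiffusionMeasureSpace

end HeatKernel


/-! ### Balls have positive measure -/

section FullSupport

variable {X 𝕜 : Type*} [RCLike 𝕜] [TopologicalSpace X] [MeasurableSpace X] [BorelSpace X]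
  {μ : Measure X} {ρ : X → X → ℝ} {φ : ℕ → X → 𝕜} {lam : ℕ → ℝ} {α : ℝ}

namespace IsDiffusionMeasureSpace

variable (h : IsDiffusionMeasureSpace μ ρ φ lam α)

include h

theorem integral_norm_sq_sum (F : Finset ℕ) (a : ℕ → 𝕜) :
    ∫ y, ‖∑ k ∈ F, a k * φ k y‖ ^ 2 ∂μ = ∑ k ∈ F, ‖a k‖ ^ 2 := by
  obtain ⟨b, hb⟩ := h.orthonormal_basis
  have hae : (∑ k ∈ F, a k • b k : Lp 𝕜 2 μ) =ᵐ[μ] fun y => ∑ k ∈ F, a k * φ k y := by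
    have h1 : ∀ᵐ y ∂μ, ∀ k, (a k • b k : Lp 𝕜 2 μ) y = a k * φ k y := by
      refine ae_all_iff.2 fun k => ?_
      filter_upwards [Lp.coeFn_smul (a k) (b k), hb k] with y hy hy'
      rw [hy, Pi.smul_apply, hy', smul_eq_mul]
    filter_upwards [Lp.coeFn_finsetSum F fun k => a k • b k, h1] with y hy hy'
    rw [hy, Finset.sum_apply]
    exact Finset.sum_congr rfl fun k _ => hy' k
  rw [← norm_sq_eq_integral _ hae]
  have h2 := b.orthonormal.inner_sum a a F
  rw [inner_self_eq_norm_sq_to_K] at h2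
  simp_rw [RCLike.conj_mul] at h2
  exact_mod_cast h2

theorem hasSum_heatKernel (x y : X) {t : ℝ} (ht : 0 < t) (ht1 : t < 1) :
    HasSum (fun k => ((Real.exp (-(lam k) ^ 2 * t) : ℝ) : 𝕜) * φ k y * starRingEnd 𝕜 (φ k x))
      (heatKernel φ lam t y x) := by
  refine (Summable.of_norm_bounded ((h.summable_heatKernel_self x ht ht1).add
    (h.summable_heatKernel_self y ht ht1)) fun k => ?_).hasSum
  rw [norm_mul, norm_mul, RCLike.norm_conj, RCLike.norm_ofReal, abs_of_pos (Real.exp_pos _),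
    ← mul_add, mul_assoc]
  refine mul_le_mul_of_nonneg_left ?_ (Real.exp_pos _).le
  nlinarith [sq_nonneg (‖φ k x‖ - ‖φ k y‖), sq_nonneg (‖φ k x‖ + ‖φ k y‖)]

/-- The semigroup identity `G_{2t}(x, x) = ∫ |G_t(x, y)|² dμ(y)`. -/
theorem integral_norm_sq_heatKernel (x : X) {t : ℝ} (ht : 0 < t) (ht1 : 2 * t < 1) :
    ∫ y, ‖heatKernel φ lam t y x‖ ^ 2 ∂μ =
      ∑' k, Real.exp (-(lam k) ^ 2 * (2 * t)) * ‖φ k x‖ ^ 2 := by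
  have := h.isProbabilityMeasure
  obtain ⟨C, hC, hup⟩ := h.exists_sum_le
  have ht1' : t < 1 := by linarith
  set a : ℕ → 𝕜 := fun k => ((Real.exp (-(lam k) ^ 2 * t) : ℝ) : 𝕜) * starRingEnd 𝕜 (φ k x)
  have ha : ∀ k, ‖a k‖ = Real.exp (-(lam k) ^ 2 * t) * ‖φ k x‖ := fun k => by
    simp only [a, norm_mul, RCLike.norm_conj, RCLike.norm_ofReal, abs_of_pos (Real.exp_pos _)]
  have ha2 : ∀ k, ‖a k‖ ^ 2 = Real.exp (-(lam k) ^ 2 * (2 * t)) * ‖φ k x‖ ^ 2 := fun k => by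
    rw [ha, mul_pow, ← Real.exp_nat_mul]
    congr 2
    push_cast
    ring
  have hlim : Tendsto (fun n => ∫ y, ‖∑ k ∈ Finset.range n, a k * φ k y‖ ^ 2 ∂μ) atTop
      (𝓝 (∫ y, ‖heatKernel φ lam t y x‖ ^ 2 ∂μ)) := by
    refine tendsto_integral_of_dominated_convergence
      (fun _ => (2 * (C * t ^ (-(α / 2)))) ^ 2) (fun n => ?_) (integrable_const _) (fun n => ?_) ?_
    · refine Continuous.aestronglyMeasurable ?_
      exact (continuous_finsetSum _ fun k _ =>
        continuous_const.mul (h.continuous_phi k)).norm.pow 2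
    · refine ae_of_all _ fun y => ?_
      rw [norm_pow, norm_norm]
      refine pow_le_pow_left₀ (norm_nonneg _) ?_ 2
      refine (norm_sum_le _ _).trans ?_
      calc ∑ k ∈ Finset.range n, ‖a k * φ k y‖
          ≤ ∑ k ∈ Finset.range n, (Real.exp (-(lam k) ^ 2 * t) * ‖φ k x‖ ^ 2 +
              Real.exp (-(lam k) ^ 2 * t) * ‖φ k y‖ ^ 2) := by
            refine Finset.sum_le_sum fun k _ => ?_
            rw [norm_mul, ha, ← mul_add, mul_assoc]
            refine mul_le_mul_of_nonneg_left ?_ (Real.exp_pos _).le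
            nlinarith [sq_nonneg (‖φ k x‖ - ‖φ k y‖), sq_nonneg (‖φ k x‖ + ‖φ k y‖)]
        _ ≤ 2 * (C * t ^ (-(α / 2))) := by
            rw [Finset.sum_add_distrib]
            linarith [hup x t ht ht1' (Finset.range n), hup y t ht ht1' (Finset.range n)]
    · refine ae_of_all _ fun y => ?_
      have h1 := (h.hasSum_heatKernel x y ht ht1').tendsto_sum_nat
      refine (h1.norm.pow 2).congr fun n => ?_
      congr 2
      exact Finset.sum_congr rfl fun k _ => by simp only [a]; ring
  refine tendsto_nhds_unique hlim ?_
  simp_rw [h.integral_norm_sq_sum, ha2]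
  exact (h.summable_heatKernel_self x (by linarith) ht1).hasSum.tendsto_sum_nat

/-- If a ball around `x` were a null set, the off-diagonal decay of the heat kernel would make
`G_{2t}(x, x) = ∫ |G_t(x, y)|² dμ(y)` exponentially small as `t → 0`, against the lower bound. -/
theorem measure_openBall_pos (x : X) {δ : ℝ} (hδ : 0 < δ) : 0 < μ (openBall ρ x δ) := by
  have := h.isProbabilityMeasure
  by_contra h0
  have h0 : μ (openBall ρ x δ) = 0 := le_antisymm (not_lt.1 h0) zero_le
  obtain ⟨c₁, hc₁, hlow⟩ := h.exists_le_tsum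
  obtain ⟨c, C, hc, hC, hup⟩ := h.heat_upper
  have key : ∀ u : ℝ, 2 < u →
      Real.exp ((2 * c * δ ^ 2) * u) / u ^ (α / 2) ≤ C ^ 2 / (c₁ * 2 ^ (-(α / 2))) := by
    intro u hu
    have hu0 : 0 < u := by linarith
    set t := u⁻¹ with ht
    have ht0 : 0 < t := inv_pos.2 hu0
    have ht2 : 2 * t < 1 := by rw [ht, ← div_eq_mul_inv, div_lt_one hu0]; exact hu
    have hint : ∫ y, ‖heatKernel φ lam t y x‖ ^ 2 ∂μ ≤
        (C * t ^ (-(α / 2)) * Real.exp (-c * (δ ^ 2 / t))) ^ 2 := by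
      have h1 : ∀ᵐ y ∂μ, ‖heatKernel φ lam t y x‖ ^ 2 ≤
          (C * t ^ (-(α / 2)) * Real.exp (-c * (δ ^ 2 / t))) ^ 2 := by
        have hae : ∀ᵐ y ∂μ, y ∉ openBall ρ x δ := measure_eq_zero_iff_ae_notMem.1 h0
        filter_upwards [hae] with y hy
        have hy' : δ ≤ ρ y x := by
          rw [h.isQuasiMetric.symm]
          simpa [openBall] using hy
        refine pow_le_pow_left₀ (norm_nonneg _) ((hup y x t ht0 (by linarith)).trans ?_) 2
        refine mul_le_mul_of_nonneg_left (Real.exp_le_exp.2 ?_) (by positivity)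
        rw [neg_mul, neg_mul, neg_le_neg_iff]
        gcongr
      refine (integral_mono_of_nonneg (ae_of_all _ fun y => by positivity) (integrable_const _)
        h1).trans_eq ?_
      simp
    have h2 := (hlow x (2 * t) (by linarith) ht2).trans_eq
      (h.integral_norm_sq_heatKernel x ht0 ht2).symm
    have h3 := h2.trans hint
    have e1 : t ^ (-(α / 2)) = u ^ (α / 2) := by
      rw [ht, Real.inv_rpow hu0.le, Real.rpow_neg hu0.le, inv_inv]
    have e2 : Real.exp (-c * (δ ^ 2 / t)) ^ 2 = (Real.exp ((2 * c * δ ^ 2) * u))⁻¹ := by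
      rw [← Real.exp_neg, ← Real.exp_nat_mul, ht, div_inv_eq_mul]
      congr 1
      push_cast
      ring
    rw [Real.mul_rpow (by norm_num) ht0.le, mul_pow, mul_pow, e1, e2] at h3
    have hw : 0 < u ^ (α / 2) := by positivity
    have hE : 0 < Real.exp ((2 * c * δ ^ 2) * u) := Real.exp_pos _
    set w := u ^ (α / 2)
    set E := Real.exp ((2 * c * δ ^ 2) * u)
    have h4 : c₁ * 2 ^ (-(α / 2)) * w * E ≤ C ^ 2 * w ^ 2 := by
      have := mul_le_mul_of_nonneg_right h3 hE.le
      rw [inv_mul_cancel_right₀ hE.ne'] at this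
      linarith
    rw [div_le_div_iff₀ hw (by positivity)]
    refine le_of_mul_le_mul_right ?_ hw
    linarith
  have hlim := tendsto_exp_mul_div_rpow_atTop (α / 2) (2 * c * δ ^ 2) (by positivity)
  obtain ⟨u, hu, hu2⟩ := ((hlim.eventually_gt_atTop (C ^ 2 / (c₁ * 2 ^ (-(α / 2))))).and
    (eventually_gt_atTop 2)).exists
  exact absurd (key u hu2) (not_le.2 hu)

theorem measure_pos_of_isNontrivialBall {B : Set X} (hB : IsNontrivialBall ρ B) : 0 < μ B := by
  have := h.isProbabilityMeasure
  obtain ⟨x, t, ht, rfl | rfl⟩ | rfl := hB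
  · exact (h.measure_openBall_pos x ht).trans_le
      (measure_mono fun y (hy : ρ x y < t) => (hy.le : ρ x y ≤ t))
  · exact h.measure_openBall_pos x ht
  · simp

end IsDiffusionMeasureSpace

end FullSupport

/-! ### Classes of diffusion polynomials in Lebesgue spaces -/

section PolynomialClasses

open Module

variable {X 𝕜 : Type*} [RCLike 𝕜] [MeasurableSpace X] {φ : ℕ → X → 𝕜} {ν : Measure X}
  {p : ℝ≥0∞}

theorem memLp_of_mem_diffusionPolynomials (lam : ℕ → ℝ) (hφ : ∀ k, MemLp (φ k) p ν) {N : ℝ}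
    {g : X → 𝕜} (hg : g ∈ diffusionPolynomials φ lam N) : MemLp g p ν := by
  induction hg using Submodule.span_induction with
  | mem g hg => obtain ⟨k, -, rfl⟩ := hg; exact hφ k
  | zero => exact MemLp.zero
  | add f g _ _ hf hg => exact hf.add hg
  | smul a g _ hg => exact hg.const_smul a

/-- The map sending a diffusion polynomial of degree at most `N` to its class in `L_p(ν)`. -/
noncomputable def polynomialToLp (lam : ℕ → ℝ) (hφ : ∀ k, MemLp (φ k) p ν) (N : ℝ) :
    diffusionPolynomials φ lam N →ₗ[𝕜] Lp 𝕜 p ν where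
  toFun g := (memLp_of_mem_diffusionPolynomials lam hφ g.2).toLp g.1
  map_add' _ _ := MemLp.toLp_add _ _
  map_smul' _ _ := MemLp.toLp_const_smul _ _

theorem coeFn_polynomialToLp (lam : ℕ → ℝ) (hφ : ∀ k, MemLp (φ k) p ν) (N : ℝ)
    (g : diffusionPolynomials φ lam N) : polynomialToLp lam hφ N g =ᵐ[ν] g.1 :=
  (memLp_of_mem_diffusionPolynomials lam hφ g.2).coeFn_toLp

/-- The dimension of the space of classes does not depend on the exponent, as the kernel of
`polynomialToLp` consists of the polynomials vanishing almost everywhere, whatever the exponent. -/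
theorem finrank_range_polynomialToLp_eq (lam : ℕ → ℝ) {q : ℝ≥0∞} (hφ : ∀ k, MemLp (φ k) p ν)
    (hφ' : ∀ k, MemLp (φ k) q ν) (N : ℝ) [FiniteDimensional 𝕜 (diffusionPolynomials φ lam N)] :
    finrank 𝕜 (polynomialToLp lam hφ N).range = finrank 𝕜 (polynomialToLp lam hφ' N).range := by
  have hker : (polynomialToLp lam hφ N).ker = (polynomialToLp lam hφ' N).ker := by
    ext g
    rw [LinearMap.mem_ker, LinearMap.mem_ker, Lp.eq_zero_iff_ae_eq_zero,
      Lp.eq_zero_iff_ae_eq_zero]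
    have h1 := coeFn_polynomialToLp lam hφ N g
    have h2 := coeFn_polynomialToLp lam hφ' N g
    exact ⟨fun h => h2.trans (h1.symm.trans h), fun h => h1.trans (h2.symm.trans h)⟩
  have h1 := (polynomialToLp lam hφ N).finrank_range_add_finrank_ker
  have h2 := (polynomialToLp lam hφ' N).finrank_range_add_finrank_ker
  rw [hker] at h1
  omega

theorem bestApproxError_eq_infEDist [Fact (1 ≤ p)] (lam : ℕ → ℝ) (hφ : ∀ k, MemLp (φ k) p ν) (N : ℝ)
    (f : Lp 𝕜 p ν) :
    bestApproxError φ lam p ν N f =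
      Metric.infEDist f ((polynomialToLp lam hφ N).range : Set (Lp 𝕜 p ν)) := by
  have hedist : ∀ g : diffusionPolynomials φ lam N,
      edist f (polynomialToLp lam hφ N g) = eLpNorm ((f : X → 𝕜) - g.1) p ν := by
    intro g
    rw [Lp.edist_def]
    exact eLpNorm_congr_ae (EventuallyEq.rfl.sub (coeFn_polynomialToLp lam hφ N g))
  refine le_antisymm (Metric.le_infEDist.2 ?_) (le_iInf₂ fun g hg => ?_)
  · rintro _ ⟨g, rfl⟩
    rw [hedist]
    exact iInf₂_le g.1 g.2
  · rw [← hedist ⟨g, hg⟩]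
    exact Metric.infEDist_le_edist_of_mem ⟨_, rfl⟩

/-- The classes in `L_p(ν)` of the diffusion polynomials of degree at most `2 ^ n`, as a real
vector space: over `ℂ` too, metric entropy sees the real dimension. -/
noncomputable def polynomialClasses [Fact (1 ≤ p)] (lam : ℕ → ℝ) (hφ : ∀ k, MemLp (φ k) p ν)
    (n : ℕ) : Submodule ℝ (Lp 𝕜 p ν) :=
  (polynomialToLp lam hφ ((2 : ℝ) ^ n)).range.restrictScalars ℝ

variable [Fact (1 ≤ p)]

theorem sobolevBall_eq_approximationBall (lam : ℕ → ℝ) (hφ : ∀ k, MemLp (φ k) p ν) (s r : ℝ) :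
    sobolevBall φ lam s p ν r = approximationBall (polynomialClasses lam hφ) s r := by
  ext f
  simp only [sobolevBall, approximationBall, sobolevNorm, mem_ofPred_eq, Lp.enorm_def,
    bestApproxError_eq_infEDist lam hφ]
  rfl

theorem monotone_polynomialClasses (lam : ℕ → ℝ) (hφ : ∀ k, MemLp (φ k) p ν) :
    Monotone (polynomialClasses lam hφ) := by
  rintro m n hmn _ ⟨g, rfl⟩
  have hle : diffusionPolynomials φ lam ((2 : ℝ) ^ m) ≤ diffusionPolynomials φ lam ((2 : ℝ) ^ n) :=
    Submodule.span_mono (image_mono fun k (hk : lam k ≤ _) =>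
      hk.trans (pow_le_pow_right₀ one_le_two hmn))
  exact ⟨⟨g.1, hle g.2⟩, rfl⟩

theorem finrank_polynomialClasses (lam : ℕ → ℝ) (hφ : ∀ k, MemLp (φ k) p ν) (n : ℕ) :
    finrank ℝ (polynomialClasses lam hφ n) =
      finrank ℝ 𝕜 * finrank 𝕜 (polynomialToLp lam hφ ((2 : ℝ) ^ n)).range :=
  (finrank_mul_finrank ℝ 𝕜 (polynomialToLp lam hφ ((2 : ℝ) ^ n)).range).symm

end PolynomialClasses

/-! ### Dimensions of the spaces of polynomial classes -/

section Dimension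

open Module

variable {X 𝕜 : Type*} [RCLike 𝕜] [TopologicalSpace X] [MeasurableSpace X] [BorelSpace X]
  {μ : Measure X} {ρ : X → X → ℝ} {φ : ℕ → X → 𝕜} {lam : ℕ → ℝ} {α : ℝ}

namespace IsDiffusionMeasureSpace

variable (h : IsDiffusionMeasureSpace μ ρ φ lam α)

include h

theorem finrank_diffusionPolynomials_le (N : ℝ) :
    FiniteDimensional 𝕜 (diffusionPolynomials φ lam N) ∧
      finrank 𝕜 (diffusionPolynomials φ lam N) ≤ (h.finite_setOf_lam_le N).toFinset.card := by
  classical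
  have e : diffusionPolynomials φ lam N =
      Submodule.span 𝕜 (((h.finite_setOf_lam_le N).toFinset.image φ : Finset (X → 𝕜)) :
        Set (X → 𝕜)) := by
    rw [Finset.coe_image, Finite.coe_toFinset, diffusionPolynomials]
  rw [e]
  exact ⟨FiniteDimensional.span_finset 𝕜 _,
    (finrank_span_finset_le_card _).trans Finset.card_image_le⟩

/-- Restriction to `B` is a contraction `L₂(μ) → L₂(B)` mapping the orthonormal `φ k` to elements
of the space of polynomial classes, so the trace bound applies. -/
theorem sum_integral_norm_sq_le_finrank (B : Set X) (N : ℝ)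
    (hφ : ∀ k, MemLp (φ k) 2 (μ.restrict B)) :
    ∑ k ∈ (h.finite_setOf_lam_le N).toFinset, ∫ x, ‖φ k x‖ ^ 2 ∂(μ.restrict B) ≤
      finrank 𝕜 (polynomialToLp lam hφ N).range := by
  have := (h.finrank_diffusionPolynomials_le N).1
  obtain ⟨b, hb⟩ := h.orthonormal_basis
  set T := LpToLpRestrictCLM X 𝕜 𝕜 μ 2 B
  have hT : ‖T‖ ≤ 1 := LinearMap.mkContinuous_norm_le _ zero_le_one _
  have hTb : ∀ k, T (b k) =ᵐ[μ.restrict B] φ k := fun k =>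
    (LpToLpRestrictCLM_coeFn 𝕜 B (b k)).trans (ae_restrict_of_ae (hb k))
  have h1 := sum_norm_sq_le_finrank T hT b.orthonormal (h.finite_setOf_lam_le N).toFinset
    (polynomialToLp lam hφ N).range fun k hk => by
      have hk' : lam k ≤ N := by simpa using hk
      refine ⟨⟨φ k, Submodule.subset_span (mem_image_of_mem φ hk')⟩, Lp.ext ?_⟩
      exact (coeFn_polynomialToLp lam hφ N _).trans (hTb k).symm
  simp_rw [fun k => norm_sq_eq_integral _ (hTb k)] at h1
  exact h1

theorem exists_le_finrank_range {B : Set X} (hB : 0 < μ B) {p : ℝ≥0∞}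
    (hφ : ∀ k, MemLp (φ k) p (μ.restrict B)) : ∃ c : ℝ, 0 < c ∧ ∀ n : ℕ,
      c * ((2 : ℝ) ^ α) ^ n ≤ finrank 𝕜 (polynomialToLp lam hφ ((2 : ℝ) ^ n)).range := by
  have := h.isProbabilityMeasure
  obtain ⟨c, hc, hlow⟩ := h.exists_le_sum_norm_sq
  have hB' : 0 < μ.real B := ENNReal.toReal_pos hB.ne' (measure_ne_top _ _)
  refine ⟨μ.real B * c, by positivity, fun n => ?_⟩
  have := (h.finrank_diffusionPolynomials_le ((2 : ℝ) ^ n)).1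
  have hφ2 : ∀ k, MemLp (φ k) 2 (μ.restrict B) := fun k => h.memLp k 2 _
  rw [finrank_range_polynomialToLp_eq lam hφ hφ2]
  refine le_trans ?_ (h.sum_integral_norm_sq_le_finrank B _ hφ2)
  rw [← integral_finsetSum _ fun k _ => h.integrable_norm_sq k _]
  calc μ.real B * c * ((2 : ℝ) ^ α) ^ n = ∫ _, c * ((2 : ℝ) ^ α) ^ n ∂(μ.restrict B) := by
        simp [mul_assoc]
    _ ≤ _ := integral_mono (integrable_const _)
        (integrable_finsetSum _ fun k _ => h.integrable_norm_sq k _) fun x => hlow n x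

theorem exists_finrank_range_le {p : ℝ≥0∞} {ν : Measure X} (hφ : ∀ k, MemLp (φ k) p ν) :
    ∃ C : ℝ, 0 < C ∧ ∀ n : ℕ,
      (finrank 𝕜 (polynomialToLp lam hφ ((2 : ℝ) ^ n)).range : ℝ) ≤ C * ((2 : ℝ) ^ α) ^ n := by
  obtain ⟨C, hC, hcard⟩ := h.exists_card_le
  refine ⟨C, hC, fun n => le_trans ?_ (hcard n)⟩
  obtain ⟨_, hle⟩ := h.finrank_diffusionPolynomials_le ((2 : ℝ) ^ n)
  exact_mod_cast (LinearMap.finrank_range_le _).trans hle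

end IsDiffusionMeasureSpace

end Dimension

end DiffusionSpace


open DiffusionSpace in
theorem theorem3p1 {X 𝕜 : Type*} [RCLike 𝕜] [TopologicalSpace X] [MeasurableSpace X]
    [BorelSpace X] (μ : Measure X) (ρ : X → X → ℝ) (φ : ℕ → X → 𝕜) (lam : ℕ → ℝ) (α : ℝ)
    (hX : DiffusionSpace.IsDiffusionMeasureSpace μ ρ φ lam α)
    (p : ℝ≥0∞) [Fact (1 ≤ p)] (s : ℝ) (hs : 0 < s)
    (B : Set X) (hB : DiffusionSpace.IsNontrivialBall ρ B) :
    (∀ r : ℝ, 0 < r →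
      IsCompact (DiffusionSpace.sobolevBall φ lam s p (μ.restrict B) r)) ∧
    ∃ c C : ℝ, 0 < c ∧ 0 < C ∧ ∀ ε r : ℝ, 0 < ε → ε ≤ r →
      (c * (r / ε) ^ (α / s) ≤
          DiffusionSpace.metricEntropy ε
            (DiffusionSpace.sobolevBall φ lam s p (μ.restrict B) r) ∧
        DiffusionSpace.metricEntropy ε
            (DiffusionSpace.sobolevBall φ lam s p (μ.restrict B) r) ≤
          C * (r / ε) ^ (α / s)) ∧
      (ε < r →
        c * (r / ε) ^ (α / s) ≤
          DiffusionSpace.closedMetricEntropy ε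
            (DiffusionSpace.sobolevBall φ lam s p (μ.restrict B) r) ∧
        DiffusionSpace.closedMetricEntropy ε
            (DiffusionSpace.sobolevBall φ lam s p (μ.restrict B) r) ≤
          C * (r / ε) ^ (α / s)) := by
  have := hX.isProbabilityMeasure
  have hφ : ∀ k, MemLp (φ k) p (μ.restrict B) := fun k => hX.memLp k p _
  obtain ⟨c, hc, hlow⟩ := hX.exists_le_finrank_range (hX.measure_pos_of_isNontrivialBall hB) hφ
  obtain ⟨C, hC, hup⟩ := hX.exists_finrank_range_le hφ
  have h𝕜 : 1 ≤ Module.finrank ℝ 𝕜 := Module.finrank_pos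
  have h𝕜2 : Module.finrank ℝ 𝕜 ≤ 2 := RCLike.finrank_le_two 𝕜
  have hlow' : ∀ n, c * ((2 : ℝ) ^ α) ^ n ≤
      Module.finrank ℝ (polynomialClasses lam hφ n) := fun n => by
    refine (hlow n).trans ?_
    rw [finrank_polynomialClasses]
    exact_mod_cast Nat.le_mul_of_pos_left _ h𝕜
  have hup' : ∀ n, (Module.finrank ℝ (polynomialClasses lam hφ n) : ℝ) ≤
      (2 * C) * ((2 : ℝ) ^ α) ^ n := fun n => by
    rw [finrank_polynomialClasses, Nat.cast_mul, mul_assoc]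
    exact mul_le_mul (by exact_mod_cast h𝕜2) (hup n) (by positivity) (by norm_num)
  have hpos : ∀ n, 0 < Module.finrank ℝ (polynomialClasses lam hφ n) := fun n => by
    have : (0 : ℝ) < c * ((2 : ℝ) ^ α) ^ n := by positivity
    exact_mod_cast this.trans_le (hlow' n)
  have hfin : ∀ n, FiniteDimensional ℝ (polynomialClasses lam hφ n) := fun n =>
    Module.finite_of_finrank_pos (hpos n)
  have hV0 : polynomialClasses lam hφ 0 ≠ ⊥ := fun h0 => by
    have := hpos 0
    rw [h0, finrank_bot] at this
    exact lt_irrefl _ this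
  simp_rw [sobolevBall_eq_approximationBall lam hφ]
  exact ⟨fun r hr => isCompact_approximationBall hs hX.alpha_pos (by positivity) hup' hr,
    entropy_approximationBall (monotone_polynomialClasses lam hφ) hV0 hs hX.alpha_pos hc
      (by positivity) hlow' hup'⟩
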